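/- Let $\delta\ge 1$ and let $\Pi=(\delta,\Sigma,\mathcal C)$ be an LCL problem on full $\delta$-ary rooted trees (finite rooted trees in which every node has $0$ or $\delta$ children): $\Sigma$ is a finite set of labels, $\mathcal C\subseteq\Sigma^{\delta+1}$ is a set of allowed configurations, and a solution on a tree is a labeling $\lambda$ of its nodes such that, for every node $v$ with $\delta$ children, the children can be ordered as $v_1,\dots,v_\delta$ with $(\lambda(v):\lambda(v_1),\dots,\lambda(v_\delta))\in\mathcal C$. A (uniform) certificate for $O(\log^* n)$ solvability of $\Pi$ consists of a non-empty set $\Sigma_{\mathcal T}\subseteq\Sigma$, a depth $d\ge 1$, and for each $\sigma\in\Sigma_{\mathcal T}$ a labeling $\mathcal T_\sigma$ of the complete $\delta$-ary tree of depth $d$ such that: each $\mathcal T_\sigma$ uses only labels of $\Sigma_{\mathcal T}$ and is a solution of $\Pi$; the root of $\mathcal T_\sigma$ has label $\sigma$; and the trees obtained from the $\mathcal T_\sigma$ by erasing the labels of all non-leaf nodes are pairwise isomorphic as rooted trees with labeled leaves. In the LOCAL model on an $n$-node tree, nodes have distinct identifiers from $\{1,\dots,N(n)\}$, where $N$ is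 a fixed function with $N(n)\ge n$ for all $n$ (for instance a polynomial), and each node initially knows $n$, its identifier, its degree, and which of its edges leads to its parent. In each synchronous round the nodes exchange arbitrary messages with their neighbours; local computation is unrestricted. The deterministic complexity $T_{\det}(n)$ of $\Pi$ is the least number of rounds in which some deterministic algorithm solves $\Pi$ on all $n$-node full $\delta$-ary trees with all identifier assignments ($\infty$ if there is none). The randomized complexity $T_{\mathrm{rand}}(n)$ is defined in the same way, where in addition each node has a private stream of independent fair random bits and, on each such instance, the output must be a solution with probability at least $1-1/n$. If $\Pi$ has no certificate for $O(\log^* n)$ solvability, then $T_{\det}(n)=\Omega(\log n)$ and $T_{\mathrm{rand}}(n)=\Omega(\log n)$, where $n$ ranges over the sizes of full $\delta$-ary trees: there are $c>0$ and $n_0$ such that $T(n)\ge c\log n$ for all such $n\ge n_0$. In particular, for each of the two complexities and every function $g(n)=o(\log n)$ (for example every $g(n)=\Theta(\log\log n)$), $T(n)>g(n)$ for all sufficiently large such $n$. -/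

import Mathlib

open MeasureTheory

/-- A finite full `δ`-ary rooted tree. Nodes are addressed by words: the root is `[]`, and the
`i`-th child of the node `p` is `i :: p`. A node with one child has all `δ` of them, so every node
has `0` or `δ` children. The numbering of the children of a node is only a local naming of the edges
(a port numbering); an algorithm has to cope with every such numbering. -/
structure FullTree (δ : ℕ) where
  nodes : Finset (List (Fin δ))
  root_mem : [] ∈ nodes
  parent_mem : ∀ (i : Fin δ) (p : List (Fin δ)), i :: p ∈ nodes → p ∈ nodes
  sibling_mem : ∀ (i j : Fin δ) (p : List (Fin δ)), i :: p ∈ nodes → j :: p ∈ nodes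

namespace FullTree

variable {δ : ℕ}

/-- The type of nodes of a tree. -/
abbrev Node (t : FullTree δ) : Type := {p : List (Fin δ) // p ∈ t.nodes}

/-- The number of nodes. -/
def size (t : FullTree δ) : ℕ := t.nodes.card

/-- The node `v` has `δ` children. For `0 < δ`, the nodes that are not internal are the leaves. -/
def IsInternal (t : FullTree δ) (v : t.Node) : Prop := ∀ i : Fin δ, i :: v.1 ∈ t.nodes

instance (t : FullTree δ) (v : t.Node) : Decidable (t.IsInternal v) :=
  inferInstanceAs (Decidable (∀ i : Fin δ, i :: v.1 ∈ t.nodes))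

/-- The `i`-th child of an internal node. -/
def child (t : FullTree δ) (v : t.Node) (h : t.IsInternal v) (i : Fin δ) : t.Node :=
  ⟨i :: v.1, h i⟩

/-- The parent of a node (`none` for the root). -/
def parent (t : FullTree δ) : t.Node → Option t.Node
  | ⟨[], _⟩ => none
  | ⟨i :: p, h⟩ => some ⟨p, t.parent_mem i p h⟩

/-- An automorphism of the rooted tree, with children unordered: a bijection of the nodes that
commutes with taking parents (in particular it fixes the root, the only node without a parent). -/
def IsAutomorphism (t : FullTree δ) (e : t.Node ≃ t.Node) : Prop :=
  ∀ v : t.Node, t.parent (e v) = (t.parent v).map e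

/-- The complete `δ`-ary tree of depth `d`: all words of length at most `d`. -/
noncomputable def complete (δ d : ℕ) : FullTree δ where
  nodes := (List.finite_length_le (Fin δ) d).toFinset
  root_mem := by simp
  parent_mem := by
    intro i p h
    simp only [Set.Finite.mem_toFinset, Set.mem_ofPred_eq, List.length_cons] at h ⊢
    omega
  sibling_mem := by
    intro i j p h
    simpa using h

end FullTree

/-- An LCL problem with `δ` children per internal node and label set `L`, given by its allowed
configurations `(a : b₁, …, b_δ)`. -/
structure LCL (δ : ℕ) (L : Type*) where
  configs : Set (L × (Fin δ → L))

/-- A solution: at every node with `δ` children, the label of the node together with the labels of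
the children, taken in some order, is an allowed configuration. -/
def LCL.IsSolution {δ : ℕ} {L : Type*} (P : LCL δ L) (t : FullTree δ) (lab : t.Node → L) : Prop :=
  ∀ (v : t.Node) (h : t.IsInternal v),
    ∃ ρ : Equiv.Perm (Fin δ), (lab v, fun i => lab (t.child v h (ρ i))) ∈ P.configs

/-- A uniform certificate for `O(log* n)` solvability with label set `S` and depth `d`: for every
label `σ ∈ S` a labeling `lab σ` of the complete `δ`-ary tree of depth `d`. -/
structure LCL.IsUniformCertificate {δ : ℕ} {L : Type*} (P : LCL δ L) (S : Set L) (d : ℕ)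
    (lab : L → (FullTree.complete δ d).Node → L) : Prop where
  nonempty : S.Nonempty
  one_le_depth : 1 ≤ d
  labels_mem : ∀ σ ∈ S, ∀ v, lab σ v ∈ S
  solution : ∀ σ ∈ S, P.IsSolution (FullTree.complete δ d) (lab σ)
  leaves_iso : ∀ σ ∈ S, ∀ τ ∈ S, ∃ e : (FullTree.complete δ d).Node ≃ (FullTree.complete δ d).Node,
    (FullTree.complete δ d).IsAutomorphism e ∧
      ∀ v, ¬ (FullTree.complete δ d).IsInternal v → lab τ (e v) = lab σ v
  root_label : ∀ σ ∈ S, lab σ ⟨[], (FullTree.complete δ d).root_mem⟩ = σ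

/-- A certificate for `O(log* n)` solvability exists. -/
def LCL.HasLogStarCertificate {δ : ℕ} {L : Type*} (P : LCL δ L) : Prop :=
  ∃ (S : Set L) (d : ℕ) (lab : L → (FullTree.complete δ d).Node → L),
    P.IsUniformCertificate S d lab

/-- A synchronous message-passing algorithm in the LOCAL model on full `δ`-ary rooted trees, with
output labels in `L`; states and messages are arbitrary. `R` is the type of the private source of
randomness of a node (`Unit` for deterministic algorithms, a stream of bits for randomized ones).

The initial knowledge of a node is the number `n` of nodes, its identifier, whether it has a
parent, and whether it has children; this determines its degree, and the maximum degree of the tree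
is determined by `n` and `δ`. In a round a node sends one message to its parent and one to each
child, receives those of its neighbours, and updates its state. -/
structure LocalAlgorithm (δ : ℕ) (L : Type*) (R : Type) where
  State : Type
  Msg : Type
  init : (n : ℕ) → (ident : ℕ) → (hasParent : Bool) → (hasChildren : Bool) → R → State
  toParent : State → Msg
  toChild : State → Fin δ → Msg
  update : State → (fromParent : Option Msg) → (fromChildren : Option (Fin δ → Msg)) → State
  output : State → L

namespace LocalAlgorithm

variable {δ : ℕ} {L : Type*} {R : Type}

/-- The message that a node receives from its parent, if it has one. -/
def fromParent (A : LocalAlgorithm δ L R) (t : FullTree δ) (s : t.Node → A.State) :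
    t.Node → Option A.Msg
  | ⟨[], _⟩ => none
  | ⟨i :: p, h⟩ => some (A.toChild (s ⟨p, t.parent_mem i p h⟩) i)

/-- The messages that a node receives from its children, if it has any. -/
def fromChildren (A : LocalAlgorithm δ L R) (t : FullTree δ) (s : t.Node → A.State)
    (v : t.Node) : Option (Fin δ → A.Msg) :=
  if h : t.IsInternal v then some (fun i => A.toParent (s (t.child v h i))) else none

/-- The states of all nodes after the given number of rounds, on the tree `t` with identifiers
`ident` and private randomness `r`. -/
def state (A : LocalAlgorithm δ L R) (t : FullTree δ) (ident : t.Node → ℕ) (r : t.Node → R) :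
    ℕ → t.Node → A.State
  | 0, v => A.init t.size (ident v) (t.parent v).isSome (decide (t.IsInternal v)) (r v)
  | k + 1, v => A.update (A.state t ident r k v) (A.fromParent t (A.state t ident r k) v)
      (A.fromChildren t (A.state t ident r k) v)

/-- The labeling that the algorithm outputs after `T` rounds. -/
def run (A : LocalAlgorithm δ L R) (t : FullTree δ) (ident : t.Node → ℕ) (r : t.Node → R)
    (T : ℕ) (v : t.Node) : L :=
  A.output (A.state t ident r T v)

end LocalAlgorithm

/-- Identifiers are distinct and come from `{1, …, N n}` on trees with `n` nodes. -/
def ValidIds {δ : ℕ} (N : ℕ → ℕ) (t : FullTree δ) (ident : t.Node → ℕ) : Prop :=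
  Function.Injective ident ∧ ∀ v, 1 ≤ ident v ∧ ident v ≤ N t.size

/-- The law of an infinite stream of independent fair random bits. -/
noncomputable def bitStream : Measure (ℕ → Bool) :=
  Measure.infinitePi (fun _ : ℕ => (PMF.uniformOfFintype Bool).toMeasure)

instance : IsProbabilityMeasure bitStream := by
  unfold bitStream
  infer_instance

/-- The law of the private random streams of the nodes of `t`: independent over the nodes. -/
noncomputable def coinLaw {δ : ℕ} (t : FullTree δ) : Measure (t.Node → ℕ → Bool) :=
  Measure.pi (fun _ : t.Node => bitStream)

namespace LCL

variable {δ : ℕ} {L : Type*}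

/-- The deterministic algorithm `A` solves `P` in `T` rounds on all trees with `n` nodes. -/
def DetSolves (P : LCL δ L) (N : ℕ → ℕ) (A : LocalAlgorithm δ L Unit) (n T : ℕ) : Prop :=
  ∀ t : FullTree δ, t.size = n → ∀ ident : t.Node → ℕ, ValidIds N t ident →
    P.IsSolution t (A.run t ident (fun _ => ()) T)

/-- The randomized (Monte Carlo) algorithm `A` solves `P` in `T` rounds on all trees with `n`
nodes: its output after `T` rounds is a random labeling (the outputs of the nodes are random
variables) that is a solution with probability at least `1 - 1 / n`. -/
def RandSolves (P : LCL δ L) (N : ℕ → ℕ) (A : LocalAlgorithm δ L (ℕ → Bool)) (n T : ℕ) : Prop :=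
  ∀ t : FullTree δ, t.size = n → ∀ ident : t.Node → ℕ, ValidIds N t ident →
    (∀ (v : t.Node) (a : L), MeasurableSet {ω : t.Node → ℕ → Bool | A.run t ident ω T v = a}) ∧
    1 - 1 / (n : ℝ) ≤ (coinLaw t).real {ω | P.IsSolution t (A.run t ident ω T)}

/-- The deterministic complexity of `P` on trees with `n` nodes: the least number of rounds in which
some algorithm solves `P` (`⊤` if there is none). -/
noncomputable def detComplexity (P : LCL δ L) (N : ℕ → ℕ) (n : ℕ) : ℕ∞ :=
  ⨅ (T : ℕ) (_ : ∃ A : LocalAlgorithm δ L Unit, P.DetSolves N A n T), (T : ℕ∞)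

/-- The randomized complexity of `P` on trees with `n` nodes. -/
noncomputable def randComplexity (P : LCL δ L) (N : ℕ → ℕ) (n : ℕ) : ℕ∞ :=
  ⨅ (T : ℕ) (_ : ∃ A : LocalAlgorithm δ L (ℕ → Bool), P.RandSolves N A n T), (T : ℕ∞)

end LCL

/-- `n` is the number of nodes of some full `δ`-ary tree (that is, `n ≡ 1` modulo `δ`, `n ≥ 1`). -/
def IsTreeSize (δ n : ℕ) : Prop := ∃ t : FullTree δ, t.size = n

/-- `f` is `Ω(log n)`, where `n` ranges over the sizes of full `δ`-ary trees. -/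
def IsOmegaLog (δ : ℕ) (f : ℕ → ℕ∞) : Prop :=
  ∃ c : ℝ, 0 < c ∧ ∃ n₀ : ℕ, ∀ n : ℕ, n₀ ≤ n → IsTreeSize δ n →
    ENNReal.ofReal (c * Real.log n) ≤ (f n : ENNReal)

/-- `f` exceeds every function `g = o(log n)` at all sufficiently large sizes of full `δ`-ary
trees. -/
def ExceedsSublog (δ : ℕ) (f : ℕ → ℕ∞) : Prop :=
  ∀ g : ℕ → ℝ, g =o[Filter.atTop] (fun n : ℕ => Real.log n) →
    ∃ n₀ : ℕ, ∀ n : ℕ, n₀ ≤ n → IsTreeSize δ n → ENNReal.ofReal (g n) < (f n : ENNReal)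

/-! Contrapositive: a randomized `T`-round algorithm that is correct on trees of some admissible
size `n ≥ K ^ (T + 1)` yields a certificate. Hence `T` is at least a constant times `log n`, and
deterministic algorithms are covered because they may ignore coins.

Fix a tree of size `n` that is complete near its root. For each threshold, consider the labels that
reach this probability at some node of depth between `T + 1` and `3 T + 3`, for some identifiers. As
the threshold decreases geometrically these sets grow, so two consecutive ones coincide
(`exists_eq_succ_of_monotone`). Let `S` be that set: each of its labels reaches the threshold `θ j`
somewhere, and every other label has probability at most `θ j / B` everywhere.

For `σ ∈ S`, locality (`state_eq_of_agree`) lets the identifiers witnessing `σ` be moved to a node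
`w` at depth `T + 1`, while the identifiers seen from `2 T + 2` levels below `w` are made the same
for all `σ` (`exists_validIds_common_low`). The view of `w` is disjoint from those low views, so the
label of `w` is independent of the low randomness. A failure, or a label outside `S`, is unlikely
even compared with `θ j`; hence most choices of low randomness extend to a good run with label `σ`
at `w` (`pi_real_mul_coinLaw_real_le`). A union bound gives one choice for all `σ`. The runs, cut
off `2 T + 2` levels below `w`, then have equal leaf labels and form a certificate
(`hasLogStarCertificate_of_runs`). -/

/-! ### Sizes of full trees. -/

namespace FullTree

variable {δ : ℕ}

/-- The node with a given address (the root if there is no such node). -/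
def node (t : FullTree δ) (u : List (Fin δ)) : t.Node :=
  if h : u ∈ t.nodes then ⟨u, h⟩ else ⟨[], t.root_mem⟩

theorem node_of_mem (t : FullTree δ) {u : List (Fin δ)} (h : u ∈ t.nodes) : t.node u = ⟨u, h⟩ :=
  dif_pos h

theorem val_node (t : FullTree δ) {u : List (Fin δ)} (h : u ∈ t.nodes) : (t.node u).1 = u := by
  rw [t.node_of_mem h]

theorem mem_complete {d : ℕ} {u : List (Fin δ)} : u ∈ (complete δ d).nodes ↔ u.length ≤ d := by
  simp [complete]

theorem size_complete_le (δ d : ℕ) : (complete δ d).size ≤ (δ + 1) ^ d := by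
  induction d with
  | zero =>
    refine Finset.card_le_one.2 fun a ha b hb => ?_
    rw [mem_complete] at ha hb
    rw [List.length_eq_zero_iff.1 (Nat.le_zero.1 ha), List.length_eq_zero_iff.1 (Nat.le_zero.1 hb)]
  | succ d ih =>
    have hsub : (complete δ (d + 1)).nodes ⊆ insert []
        ((Finset.univ ×ˢ (complete δ d).nodes).image fun x : Fin δ × List (Fin δ) => x.1 :: x.2) := by
      intro u hu
      rw [mem_complete] at hu
      cases u with
      | nil => simp
      | cons i p =>
        refine Finset.mem_insert_of_mem (Finset.mem_image.2 ⟨(i, p), ?_, rfl⟩)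
        simpa [mem_complete] using hu
    have h1 : (complete δ (d + 1)).size ≤ δ * (complete δ d).size + 1 := by
      refine (Finset.card_le_card hsub).trans ((Finset.card_insert_le _ _).trans ?_)
      refine Nat.add_le_add_right (Finset.card_image_le.trans ?_) 1
      simp [size]
    have h2 : 1 ≤ (δ + 1) ^ d := Nat.one_le_pow _ _ (Nat.succ_pos _)
    calc _ ≤ δ * (δ + 1) ^ d + 1 := h1.trans (Nat.add_le_add_right (Nat.mul_le_mul_left _ ih) 1)
      _ ≤ _ := by rw [pow_succ]; nlinarith

/-- Non-root nodes correspond to pairs of a letter and an internal node; `k` counts the internal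
nodes. -/
theorem size_eq (t : FullTree δ) : ∃ k, t.size = 1 + δ * k := by
  classical
  set I := t.nodes.filter fun p => ∃ i : Fin δ, i :: p ∈ t.nodes with hI
  refine ⟨I.card, ?_⟩
  have : t.nodes = insert []
      ((Finset.univ ×ˢ I).image fun x : Fin δ × List (Fin δ) => x.1 :: x.2) := by
    ext u
    cases u with
    | nil => simp [t.root_mem]
    | cons i p =>
      simp only [Finset.mem_insert, reduceCtorEq, false_or, Finset.mem_image, Finset.mem_product,
        Finset.mem_univ, true_and, Prod.exists, List.cons.injEq, hI, Finset.mem_filter]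
      constructor
      · exact fun h => ⟨i, p, ⟨t.parent_mem i p h, i, h⟩, rfl, rfl⟩
      · rintro ⟨j, q, ⟨_, k, hk⟩, rfl, rfl⟩
        exact t.sibling_mem k j q hk
  rw [size, this, Finset.card_insert_of_notMem (by simp), Finset.card_image_of_injective]
  · simp [add_comm]
  · rintro ⟨i, p⟩ ⟨j, q⟩ h
    simpa using h

/-- Giving `δ` children to a deepest node. -/
theorem exists_size_add (t : FullTree δ) :
    ∃ t' : FullTree δ, t.nodes ⊆ t'.nodes ∧ t'.size = t.size + δ := by
  classical
  obtain ⟨p, hp, hmax⟩ := t.nodes.exists_max_image List.length ⟨_, t.root_mem⟩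
  set C : Finset (List (Fin δ)) := Finset.univ.image fun i : Fin δ => i :: p with hC
  -- A deepest node is a leaf, so the added children are new.
  have hdeep : ∀ (i : Fin δ) (q : List (Fin δ)), i :: q ∈ t.nodes → q ≠ p := by
    rintro i q hq rfl
    simpa using hmax _ hq
  refine ⟨⟨t.nodes ∪ C, Finset.mem_union_left _ t.root_mem, ?_, ?_⟩, Finset.subset_union_left, ?_⟩
  · intro i q h
    rcases Finset.mem_union.1 h with h | h
    · exact Finset.mem_union_left _ (t.parent_mem i q h)
    · obtain ⟨j, -, hj⟩ := Finset.mem_image.1 h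
      obtain ⟨rfl, rfl⟩ := List.cons.inj hj
      exact Finset.mem_union_left _ hp
  · intro i j q h
    rcases Finset.mem_union.1 h with h | h
    · exact Finset.mem_union_left _ (t.sibling_mem i j q h)
    · obtain ⟨k, -, hk⟩ := Finset.mem_image.1 h
      obtain ⟨rfl, rfl⟩ := List.cons.inj hk
      exact Finset.mem_union_right _ (Finset.mem_image_of_mem _ (Finset.mem_univ _))
  · rw [size, Finset.card_union_of_disjoint, Finset.card_image_of_injective]
    · simp [size]
    · intro i j h
      exact (List.cons.inj h).1
    · rw [Finset.disjoint_right]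
      intro u hu hu'
      obtain ⟨j, -, rfl⟩ := Finset.mem_image.1 hu
      exact hdeep _ _ hu' rfl

/-- A tree of any admissible size that contains a complete tree. -/
theorem exists_size_eq_of_complete {n d : ℕ} (hn : IsTreeSize δ n)
    (hd : (complete δ d).size ≤ n) :
    ∃ t : FullTree δ, t.size = n ∧ ∀ u : List (Fin δ), u.length ≤ d → u ∈ t.nodes := by
  have key : ∀ k, ∃ t : FullTree δ, t.size = (complete δ d).size + δ * k ∧
      ∀ u : List (Fin δ), u.length ≤ d → u ∈ t.nodes := by
    intro k
    induction k with
    | zero => exact ⟨complete δ d, by simp, fun u hu => mem_complete.2 hu⟩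
    | succ k ih =>
      obtain ⟨t, ht, hsub⟩ := ih
      obtain ⟨t', ht', hs⟩ := t.exists_size_add
      exact ⟨t', by rw [hs, ht]; ring, fun u hu => ht' (hsub u hu)⟩
  obtain ⟨t, rfl⟩ := hn
  obtain ⟨a, ha⟩ := t.size_eq
  obtain ⟨b, hb⟩ := (complete δ d).size_eq
  rcases Nat.eq_zero_or_pos δ with h0 | h0
  · obtain ⟨t', ht', hs⟩ := key 0
    subst h0
    exact ⟨t', by rw [ht', ha, hb]; simp, hs⟩
  · have hba : b ≤ a := by
      rw [ha, hb] at hd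
      exact Nat.le_of_mul_le_mul_left (by omega) h0
    obtain ⟨t', ht', hs⟩ := key (a - b)
    refine ⟨t', ?_, hs⟩
    rw [ht', ha, hb, add_assoc, ← mul_add, Nat.add_sub_cancel' hba]

end FullTree

/-! ### Identifiers. -/

/-- A partial assignment of distinct identifiers extends to all nodes. -/
theorem exists_validIds_extending {δ : ℕ} {N : ℕ → ℕ} (hN : ∀ n, n ≤ N n) (t : FullTree δ)
    (s : Finset t.Node) (f : t.Node → ℕ) (hf : Set.InjOn f s)
    (hf' : ∀ v ∈ s, 1 ≤ f v ∧ f v ≤ N t.size) :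
    ∃ ident : t.Node → ℕ, ValidIds N t ident ∧ ∀ v ∈ s, ident v = f v := by
  classical
  have hcard : Fintype.card t.Node = t.size := by simp [FullTree.size]
  have h1 : s.image f ⊆ Finset.Icc 1 (N t.size) := by
    intro x hx
    obtain ⟨v, hv, rfl⟩ := Finset.mem_image.1 hx
    exact Finset.mem_Icc.2 (hf' v hv)
  -- The used values are enlarged to a set of exactly `t.size` identifiers, which exists because `n
  -- ≤ N n`; the partial injection then extends to a bijection onto it.
  obtain ⟨J, hJ1, hJ2, hJ⟩ := Finset.exists_subsuperset_card_eq (n := t.size) h1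
    (Finset.card_image_le.trans (hcard ▸ s.card_le_univ)) (by simpa using hN t.size)
  obtain ⟨g, hg⟩ := Finset.exists_equiv_extend_of_card_eq (hcard.trans hJ.symm) hJ1 hf
  exact ⟨fun v => (g v : ℕ), ⟨fun v w h => g.injective (Subtype.ext h),
    fun v => Finset.mem_Icc.1 (hJ2 (g v).2)⟩, hg⟩

/-! ### Locality. -/

namespace LocalAlgorithm

variable {δ : ℕ} {L : Type*} {R : Type}

theorem fromParent_node (A : LocalAlgorithm δ L R) (t : FullTree δ) (s : t.Node → A.State)
    {i : Fin δ} {p : List (Fin δ)} (h : i :: p ∈ t.nodes) :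
    A.fromParent t s (t.node (i :: p)) = some (A.toChild (s (t.node p)) i) := by
  rw [t.node_of_mem h, t.node_of_mem (t.parent_mem i p h)]
  rfl

theorem fromChildren_node (A : LocalAlgorithm δ L R) (t : FullTree δ) (s : t.Node → A.State)
    {p : List (Fin δ)} (hp : p ∈ t.nodes) (h : ∀ i, i :: p ∈ t.nodes) :
    A.fromChildren t s (t.node p) = some fun i => A.toParent (s (t.node (i :: p))) := by
  have hi : t.IsInternal (t.node p) := by rwa [FullTree.IsInternal, t.val_node hp]
  rw [fromChildren, dif_pos hi]
  congr! with i
  rw [t.node_of_mem (h i)]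
  exact Subtype.ext (congrArg (i :: ·) (t.val_node hp))

/-- Locality: inside a complete part of the tree, the state of a node after `k` rounds depends only
on identifiers and randomness at distance at most `k`, and not on the address of the node apart
from its last `k` letters. -/
theorem state_eq_of_agree (A : LocalAlgorithm δ L R) {t : FullTree δ} {D : ℕ}
    (hD : ∀ u : List (Fin δ), u.length ≤ D → u ∈ t.nodes) {ident ident' : t.Node → ℕ}
    {r r' : t.Node → R} {z z' : List (Fin δ)} (k : ℕ) (q : List (Fin δ)) (hk : k < q.length)
    (hz : q.length + k + z.length < D) (hz' : q.length + k + z'.length < D)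
    (hagree : ∀ u : List (Fin δ), q.length ≤ u.length + k → u.length ≤ q.length + k →
      ident (t.node (u ++ z)) = ident' (t.node (u ++ z')) ∧
        r (t.node (u ++ z)) = r' (t.node (u ++ z'))) :
    A.state t ident r k (t.node (q ++ z)) = A.state t ident' r' k (t.node (q ++ z')) := by
  induction k generalizing q with
  | zero =>
    obtain ⟨h1, h2⟩ := hagree q le_rfl le_rfl
    have aux : ∀ y : List (Fin δ), q.length + 0 + y.length < D →
        (t.parent (t.node (q ++ y))).isSome = true ∧ t.IsInternal (t.node (q ++ y)) := by
      intro y hy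
      have hm : q ++ y ∈ t.nodes := hD _ (by simp; omega)
      constructor
      · cases q with
        | nil => simp at hk
        | cons i p => rw [t.node_of_mem hm]; rfl
      · intro i
        rw [t.val_node hm]
        exact hD _ (by simp; omega)
    simp only [state, h1, h2, aux z hz, aux z' hz']
  | succ k ih =>
    have hq := ih q (by omega) (by omega) (by omega) fun u h1 h2 => hagree u (by omega) (by omega)
    cases q with
    | nil => simp at hk
    | cons i p =>
      simp only [List.length_cons] at hk hz hz' hagree
      -- The bound `k + 1 < q.length` leaves the parent `p` with more than `k` letters, so the
      -- recursion never reaches the node `z` itself, and every port number used upwards is a letter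
      -- of `q`.
      have hp := ih p (by omega) (by omega) (by omega)
        fun u h1 h2 => hagree u (by omega) (by omega)
      have hc : ∀ j : Fin δ, _ := fun j => ih (j :: i :: p) (by simp; omega) (by simp; omega)
        (by simp; omega) fun u h1 h2 => by
          simp only [List.length_cons] at h1 h2
          exact hagree u (by omega) (by omega)
      simp only [List.cons_append] at hq hc ⊢
      simp only [state, hq]
      rw [fromParent_node, fromParent_node, fromChildren_node, fromChildren_node, hp]
      · simp only [hc]
      all_goals first
        | (refine hD _ ?_; simp; omega)
        | (intro j; refine hD _ ?_; simp; omega)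

end LocalAlgorithm

/-! ### Independence in product measures. -/

section Product

variable {ι κ R : Type*} [Fintype ι] [Fintype κ] [MeasurableSpace R]

/-- For an i.i.d. family, an event about some coordinates and an event about the others are
independent, and the former has the probability that it has for the subfamily; no measurability is
needed. -/
theorem pi_preimage_comp_inter (μ : Measure R) [IsProbabilityMeasure μ] {j : κ → ι}
    (hj : Function.Injective j) (B : Set (κ → R)) (E : Set (ι → R))
    (hE : ∀ ω ω' : ι → R, (∀ i ∉ Set.range j, ω i = ω' i) → ω ∈ E → ω' ∈ E) :
    Measure.pi (fun _ : ι => μ) ({ω | ω ∘ j ∈ B} ∩ E) =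
      Measure.pi (fun _ : κ => μ) B * Measure.pi (fun _ : ι => μ) E := by
  classical
  let e : κ ⊕ {i // i ∉ Set.range j} ≃ ι :=
    ((Equiv.ofInjective j hj).sumCongr (Equiv.refl _)).trans (Equiv.sumCompl (· ∈ Set.range j))
  have hel : ∀ q, e (Sum.inl q) = j q := fun q => rfl
  have her : ∀ x, e (Sum.inr x) = x.1 := fun x => rfl
  have h1 := measurePreserving_piCongrLeft (α := fun _ : ι => R) (fun _ : ι => μ) e
  have h2 := measurePreserving_sumPiEquivProdPi (X := fun _ : κ ⊕ {i // i ∉ Set.range j} => R)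
    (fun _ => μ)
  have h3 := h1.symm.trans h2
  set Φ := (MeasurableEquiv.piCongrLeft (fun _ : ι => R) e).symm.trans
    (MeasurableEquiv.sumPiEquivProdPi (fun _ : κ ⊕ {i // i ∉ Set.range j} => R)) with hΦ
  have hΦ1 : ∀ ω, (Φ ω).1 = ω ∘ j := fun ω => rfl
  have hΦ2 : ∀ ω, (Φ ω).2 = fun x => ω x.1 := fun ω => rfl
  set E' : Set ({i // i ∉ Set.range j} → R) := (fun ω : ι → R => fun x => ω x.1) '' E with hE'
  have hEE' : ∀ ω, ω ∈ E ↔ (Φ ω).2 ∈ E' := by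
    intro ω
    rw [hΦ2]
    refine ⟨fun h => ⟨ω, h, rfl⟩, ?_⟩
    rintro ⟨ω', h, hω⟩
    exact hE ω' ω (fun i hi => congrFun hω ⟨i, hi⟩) h
  have key : ∀ C : Set (κ → R), Measure.pi (fun _ : ι => μ) ({ω | ω ∘ j ∈ C} ∩ E) =
      Measure.pi (fun _ : κ => μ) C * Measure.pi (fun _ : {i // i ∉ Set.range j} => μ) E' := by
    intro C
    have : {ω | ω ∘ j ∈ C} ∩ E = Φ ⁻¹' (C ×ˢ E') := by
      ext ω
      simp only [Set.mem_inter_iff, Set.mem_ofPred_eq, Set.mem_preimage, Set.mem_prod, hEE', hΦ1]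
    -- Both rewrites hold for arbitrary sets, which is why no measurability is required.
    rw [this, h3.measure_preimage_equiv, Measure.prod_prod]
  have hu := key Set.univ
  rw [measure_univ, one_mul] at hu
  rw [key B, ← hu]
  simp

/-- Functions of the randomness at corresponding coordinates have the same law. -/
theorem pi_setOf_eq_of_comp {X : Type*} {ι' : Type*} [Fintype ι'] (μ : Measure R)
    [IsProbabilityMeasure μ] {j : κ → ι} {j' : κ → ι'}
    (hj : Function.Injective j) (hj' : Function.Injective j') (f : (ι → R) → X)
    (f' : (ι' → R) → X) (h : ∀ ω ω', ω ∘ j = ω' ∘ j' → f ω = f' ω') (a : X) :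
    Measure.pi (fun _ : ι => μ) {ω | f ω = a} = Measure.pi (fun _ : ι' => μ) {ω | f' ω = a} := by
  have hR : Nonempty R := by
    by_contra hR
    rw [not_nonempty_iff] at hR
    simpa [Set.univ_eq_empty_iff.2 hR] using measure_univ (μ := μ)
  have hx : ∀ x : κ → R, ∃ ω : ι → R, ω ∘ j = x := fun x =>
    ⟨Function.extend j x fun _ => Classical.arbitrary R, funext fun q => hj.extend_apply _ _ q⟩
  have hx' : ∀ x : κ → R, ∃ ω : ι' → R, ω ∘ j' = x := fun x =>
    ⟨Function.extend j' x fun _ => Classical.arbitrary R, funext fun q => hj'.extend_apply _ _ q⟩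
  -- By `h`, both events are preimages of this one event on `κ → R`. Since `h` only compares `f`
  -- with `f'`, the first case passes through an auxiliary `ω'`.
  have h1 := pi_preimage_comp_inter μ hj {x | ∃ ω, ω ∘ j = x ∧ f ω = a} Set.univ (by simp)
  have h2 := pi_preimage_comp_inter μ hj' {x | ∃ ω, ω ∘ j = x ∧ f ω = a} Set.univ (by simp)
  simp only [Set.inter_univ, measure_univ, mul_one, Set.mem_ofPred_eq] at h1 h2
  have e1 : {ω | f ω = a} = {ω | ∃ ω₁, ω₁ ∘ j = ω ∘ j ∧ f ω₁ = a} := by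
    ext ω
    refine ⟨fun hω => ⟨ω, rfl, hω⟩, ?_⟩
    rintro ⟨ω₁, h₁, h₂⟩
    obtain ⟨ω', hω'⟩ := hx' (ω ∘ j)
    exact (h ω ω' hω'.symm).trans ((h ω₁ ω' (h₁.trans hω'.symm)).symm.trans h₂)
  have e2 : {ω | f' ω = a} = {ω | ∃ ω₁, ω₁ ∘ j = ω ∘ j' ∧ f ω₁ = a} := by
    ext ω
    constructor
    · intro hω
      obtain ⟨ω₁, h₁⟩ := hx (ω ∘ j')
      exact ⟨ω₁, h₁, (h _ _ h₁).trans hω⟩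
    · rintro ⟨ω₁, h₁, h₂⟩
      exact (h _ _ h₁).symm.trans h₂
  rw [e1, e2, h1, h2]

end Product

/-! ### Identifiers common to several runs. -/

/-- The addresses of length in `(T, 3 T + 2]`. Below a node, those at relative depth at least
`T + 2` are what the nodes at relative depth `2 T + 2` see within `T` rounds. -/
noncomputable def lowAddresses (δ T : ℕ) : Finset (List (Fin δ)) :=
  (FullTree.complete δ (3 * T + 2)).nodes.filter fun q => T < q.length

theorem mem_lowAddresses {δ T : ℕ} {q : List (Fin δ)} :
    q ∈ lowAddresses δ T ↔ T < q.length ∧ q.length ≤ 3 * T + 2 := by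
  simp [lowAddresses, FullTree.mem_complete, and_comm]

theorem FullTree.injective_node_append {δ : ℕ} {t : FullTree δ} {κ : Type*}
    {g : κ → List (Fin δ)} (hg : Function.Injective g) {z : List (Fin δ)}
    (h : ∀ x, g x ++ z ∈ t.nodes) : Function.Injective fun x => t.node (g x ++ z) := by
  intro x y hxy
  have := congrArg Subtype.val hxy
  simp only [t.val_node (h x), t.val_node (h y)] at this
  exact hg (List.append_cancel_right this)

/-- Finitely many identifier assignments near a root can be combined with one and the same
assignment at low addresses below that root. -/
theorem exists_validIds_common_low {δ : ℕ} {N : ℕ → ℕ} (hN : ∀ n, n ≤ N n) {t : FullTree δ} {T : ℕ}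
    (hD : ∀ u : List (Fin δ), u.length ≤ 4 * T + 4 → u ∈ t.nodes) {Λ : Type*} [Fintype Λ]
    (hcard : (Fintype.card Λ + 1) * (δ + 1) ^ (4 * T + 4) ≤ t.size)
    (w z : Λ → List (Fin δ)) (hw : ∀ σ, (w σ).length = T + 1)
    (hz : ∀ σ, (z σ).length ≤ 2 * T + 2) (idW : Λ → t.Node → ℕ)
    (hidW : ∀ σ, ValidIds N t (idW σ)) :
    ∃ I : lowAddresses δ T → ℕ, ∀ σ, ∃ ident : t.Node → ℕ, ValidIds N t ident ∧
      (∀ u : List (Fin δ), u.length ≤ 2 * T + 1 →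
        ident (t.node u) = idW σ (t.node (u ++ z σ))) ∧
      ∀ q : lowAddresses δ T, ident (t.node (q.1 ++ w σ)) = I q := by
  classical
  have hpow : ∀ k ≤ 4 * T + 4, (FullTree.complete δ k).nodes.card ≤ (δ + 1) ^ (4 * T + 4) :=
    fun k hk => (FullTree.size_complete_le δ k).trans (Nat.pow_le_pow_right (Nat.succ_pos _) hk)
  set U := (FullTree.complete δ (2 * T + 1)).nodes with hU
  -- The low identifiers are chosen once, so they must avoid the identifiers near the root for every
  -- `σ` at once.
  set used : Finset ℕ := Finset.univ.biUnion fun σ =>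
    U.image fun u => idW σ (t.node (u ++ z σ)) with hused
  have hused_card : used.card ≤ Fintype.card Λ * (δ + 1) ^ (4 * T + 4) := by
    refine Finset.card_biUnion_le.trans ((Finset.sum_le_card_nsmul _ _ _ fun σ _ =>
      Finset.card_image_le.trans (hpow _ (by omega))).trans ?_)
    simp
  have hI : Fintype.card (lowAddresses δ T) ≤
      Fintype.card (Finset.Icc 1 (N t.size) \ used : Finset ℕ) := by
    rw [Fintype.card_coe, Fintype.card_coe]
    have h1 := Finset.le_card_sdiff used (Finset.Icc 1 (N t.size))
    have h2 : (lowAddresses δ T).card ≤ (δ + 1) ^ (4 * T + 4) :=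
      (Finset.card_filter_le _ _).trans (hpow _ (by omega))
    have h3 := hN t.size
    rw [Nat.card_Icc] at h1
    rw [add_one_mul] at hcard
    omega
  obtain ⟨I⟩ := Function.Embedding.nonempty_of_card_le hI
  have hImem : ∀ q, (1 ≤ (I q : ℕ) ∧ (I q : ℕ) ≤ N t.size) ∧ (I q : ℕ) ∉ used := fun q => by
    simpa only [Finset.mem_sdiff, Finset.mem_Icc] using (I q).2
  refine ⟨fun q => I q, fun σ => ?_⟩
  -- The `take` strips the suffix `w σ` of length `T + 1`. The default `0` is never read: only the
  -- two families of nodes below are prescribed.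
  let f : t.Node → ℕ := fun v => if v.1.length ≤ 2 * T + 1 then idW σ (t.node (v.1 ++ z σ)) else
    if h : v.1.take (v.1.length - (T + 1)) ∈ lowAddresses δ T then I ⟨_, h⟩ else 0
  have hmemU : ∀ u : List (Fin δ), u.length ≤ 2 * T + 1 → u ∈ t.nodes := fun u hu =>
    hD u (by omega)
  have hmemUz : ∀ u : List (Fin δ), u.length ≤ 2 * T + 1 → u ++ z σ ∈ t.nodes := fun u hu =>
    hD _ (by have := hz σ; simp; omega)
  have hmemQ : ∀ q : lowAddresses δ T, q.1 ++ w σ ∈ t.nodes := fun q =>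
    hD _ (by have := mem_lowAddresses.1 q.2; have := hw σ; simp; omega)
  have hfU : ∀ u : List (Fin δ), u.length ≤ 2 * T + 1 →
      f (t.node u) = idW σ (t.node (u ++ z σ)) := by
    intro u hu
    simp only [f, t.val_node (hmemU u hu), if_pos hu]
  have hfQ : ∀ q : lowAddresses δ T, f (t.node (q.1 ++ w σ)) = I q := by
    intro q
    have hq := mem_lowAddresses.1 q.2
    have hl : (q.1 ++ w σ).length = q.1.length + (T + 1) := by simp [hw σ]
    have htake : (q.1 ++ w σ).take ((q.1 ++ w σ).length - (T + 1)) = q.1 := by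
      rw [hl, Nat.add_sub_cancel, List.take_left']
      rfl
    have hn : ¬ (q.1 ++ w σ).length ≤ 2 * T + 1 := by omega
    simp only [f, t.val_node (hmemQ q), if_neg hn, htake]
    rw [dif_pos q.2]
  have hUused : ∀ u : List (Fin δ), u.length ≤ 2 * T + 1 → f (t.node u) ∈ used := by
    intro u hu
    rw [hfU u hu]
    exact Finset.mem_biUnion.2 ⟨σ, Finset.mem_univ _,
      Finset.mem_image_of_mem _ (FullTree.mem_complete.2 hu)⟩
  obtain ⟨ident, hval, hext⟩ := exists_validIds_extending hN t
    (U.image t.node ∪ Finset.univ.image fun q : lowAddresses δ T => t.node (q.1 ++ w σ)) f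
    (by
      intro v hv v' hv' hvv'
      simp only [Finset.coe_union, Finset.coe_image, Set.mem_union, Set.mem_image,
        Finset.mem_coe, hU, FullTree.mem_complete, Finset.mem_univ, true_and] at hv hv'
      rcases hv with ⟨u, hu, rfl⟩ | ⟨q, rfl⟩ <;> rcases hv' with ⟨u', hu', rfl⟩ | ⟨q', rfl⟩
      · rw [hfU u hu, hfU u' hu'] at hvv'
        have := congrArg Subtype.val ((hidW σ).1 hvv')
        rw [t.val_node (hmemUz u hu), t.val_node (hmemUz u' hu')] at this
        rw [List.append_cancel_right this]
      · have := hUused u hu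
        rw [hvv', hfQ] at this
        exact absurd this (hImem q').2
      · have := hUused u' hu'
        rw [← hvv', hfQ] at this
        exact absurd this (hImem q).2
      · rw [hfQ, hfQ] at hvv'
        rw [I.injective (Subtype.ext hvv')])
    (by
      intro v hv
      simp only [Finset.mem_union, Finset.mem_image, hU, FullTree.mem_complete, Finset.mem_univ,
        true_and] at hv
      rcases hv with ⟨u, hu, rfl⟩ | ⟨q, rfl⟩
      · rw [hfU u hu]
        exact (hidW σ).2 _
      · rw [hfQ]
        exact (hImem q).1)
  refine ⟨ident, hval, fun u hu => ?_, fun q => ?_⟩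
  · rw [hext _ (Finset.mem_union_left _ (Finset.mem_image_of_mem _ (FullTree.mem_complete.2 hu))),
      hfU u hu]
  · rw [hext _ (Finset.mem_union_right _ (Finset.mem_image_of_mem
      (fun q : lowAddresses δ T => t.node (q.1 ++ w σ)) (Finset.mem_univ q))), hfQ]

/-! ### Pigeonhole and union bound. -/

/-- An increasing sequence of sets of labels is stationary at some early step. -/
theorem exists_eq_succ_of_monotone {L : Type*} [Fintype L] {S : ℕ → Finset L} (hS : Monotone S) :
    ∃ j ≤ Fintype.card L, S j = S (j + 1) := by
  by_contra! h
  have key : ∀ j ≤ Fintype.card L + 1, j ≤ (S j).card := by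
    intro j
    induction j with
    | zero => simp
    | succ j ih =>
      intro hj
      have := Finset.card_lt_card (lt_of_le_of_ne (hS (Nat.le_succ j)) (h j (by omega)))
      have := ih (by omega)
      simp only [Nat.succ_eq_add_one] at *
      omega
  have h1 := key _ le_rfl
  have h2 := (S (Fintype.card L + 1)).card_le_univ
  omega

theorem exists_forall_notMem_of_measureReal_lt {X Λ : Type*} [MeasurableSpace X] [Fintype Λ]
    (μ : Measure X) [IsProbabilityMeasure μ] (B : Λ → Set X) {ℓ : ℕ} (hℓ : Fintype.card Λ ≤ ℓ)
    (hB : ∀ σ, μ.real (B σ) * ℓ < 1) : ∃ x, ∀ σ, x ∉ B σ := by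
  by_contra! h
  have huniv : (⋃ σ, B σ) = Set.univ := Set.eq_univ_of_forall fun x => Set.mem_iUnion.2 (h x)
  have h1 : 1 ≤ ∑ σ, μ.real (B σ) := by
    calc (1 : ℝ) = μ.real (⋃ σ, B σ) := by rw [huniv, probReal_univ]
      _ ≤ _ := measureReal_iUnion_fintype_le _
  obtain ⟨x⟩ : Nonempty X := by
    by_contra hX
    rw [not_nonempty_iff] at hX
    simpa [Set.univ_eq_empty_iff.2 hX] using measure_univ (μ := μ)
  obtain ⟨σ₀, -⟩ := h x
  have hcard : (0 : ℝ) < Fintype.card Λ := by exact_mod_cast Fintype.card_pos_iff.2 ⟨σ₀⟩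
  have hℓ' : (Fintype.card Λ : ℝ) ≤ ℓ := by exact_mod_cast hℓ
  have h2 : ∑ σ, μ.real (B σ) * ℓ < ∑ _σ : Λ, (1 : ℝ) :=
    Finset.sum_lt_sum_of_nonempty ⟨σ₀, Finset.mem_univ _⟩ fun σ _ => hB σ
  rw [← Finset.sum_mul] at h2
  simp only [Finset.sum_const, Finset.card_univ, nsmul_eq_mul, mul_one] at h2
  nlinarith

instance {δ : ℕ} (t : FullTree δ) : IsProbabilityMeasure (coinLaw t) := by
  unfold coinLaw
  infer_instance

/-! ### Probabilities of failures and of outputs. -/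

namespace LCL

variable {δ : ℕ} {L : Type*} [Finite L]

/-- Passing to the complement needs a measurable event; finiteness of `L` and measurability of each
output provide it. -/
theorem RandSolves.measureReal_not_isSolution_le {P : LCL δ L} {N : ℕ → ℕ}
    {A : LocalAlgorithm δ L (ℕ → Bool)} {n T : ℕ} (h : P.RandSolves N A n T) {t : FullTree δ}
    (ht : t.size = n) {ident : t.Node → ℕ} (hid : ValidIds N t ident) :
    (coinLaw t).real {ω | ¬ P.IsSolution t (A.run t ident ω T)} ≤ 1 / (n : ℝ) := by
  obtain ⟨hm, hp⟩ := h t ht ident hid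
  let _ : MeasurableSpace L := ⊤
  have hmeas : Measurable fun ω : t.Node → ℕ → Bool => A.run t ident ω T :=
    measurable_pi_iff.2 fun v => measurable_to_countable' fun a => hm v a
  have hset : MeasurableSet {ω | P.IsSolution t (A.run t ident ω T)} :=
    hmeas (Set.toFinite {lab | P.IsSolution t lab}).measurableSet
  have := probReal_compl_eq_one_sub (μ := coinLaw t) hset
  rw [Set.compl_ofPred] at this
  linarith

end LCL

namespace LocalAlgorithm

variable {δ : ℕ} {L : Type*}

/-- The law of the output of a node depends only on identifiers near it and on the last letters of
its address. -/
theorem coinLaw_real_run_eq (A : LocalAlgorithm δ L (ℕ → Bool)) {t : FullTree δ} {T : ℕ}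
    (hD : ∀ u : List (Fin δ), u.length ≤ 4 * T + 4 → u ∈ t.nodes) {ident ident' : t.Node → ℕ}
    {w z : List (Fin δ)} (hw : w.length = T + 1) (hz : z.length ≤ 2 * T + 2)
    (hid : ∀ u : List (Fin δ), u.length ≤ 2 * T + 1 →
      ident (t.node u) = ident' (t.node (u ++ z))) (a : L) :
    (coinLaw t).real {ω | A.run t ident ω T (t.node w) = a} =
      (coinLaw t).real {ω | A.run t ident' ω T (t.node (w ++ z)) = a} := by
  let g : (FullTree.complete δ (2 * T + 1)).Node → List (Fin δ) := fun x => x.1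
  have hg : Function.Injective g := Subtype.val_injective
  have hlen : ∀ x, (g x).length ≤ 2 * T + 1 := fun x => FullTree.mem_complete.1 x.2
  have h1 : Function.Injective fun x => t.node (g x ++ []) :=
    FullTree.injective_node_append hg fun x => hD _ (by have := hlen x; simp; omega)
  have h2 : Function.Injective fun x => t.node (g x ++ z) :=
    FullTree.injective_node_append hg fun x => hD _ (by have := hlen x; simp; omega)
  refine congrArg ENNReal.toReal (pi_setOf_eq_of_comp bitStream h1 h2 _ _ (fun ω ω' h => ?_) a)
  have := A.state_eq_of_agree hD (ident := ident) (ident' := ident') (r := ω) (r' := ω') (z := [])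
    (z' := z) T w (by omega) (by simp; omega) (by omega) fun u _ hu => by
      have hu' : u.length ≤ 2 * T + 1 := by omega
      have hr := congrFun h ⟨u, FullTree.mem_complete.2 hu'⟩
      rw [List.append_nil]
      exact ⟨hid u hu', by simpa [g] using hr⟩
  rw [List.append_nil] at this
  exact congrArg A.output this

/-- If an event `F` is unlikely, then for most choices of the randomness at low addresses it can be
avoided while the root has a given, not too unlikely, label. -/
theorem pi_real_mul_coinLaw_real_le (A : LocalAlgorithm δ L (ℕ → Bool)) {t : FullTree δ} {T : ℕ}
    (hD : ∀ u : List (Fin δ), u.length ≤ 4 * T + 4 → u ∈ t.nodes) (ident : t.Node → ℕ)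
    {w : List (Fin δ)} (hw : w.length = T + 1) (a : L) (F : Set (t.Node → ℕ → Bool)) :
    (Measure.pi fun _ : lowAddresses δ T => bitStream).real
        {x | ∀ ω, (fun q : lowAddresses δ T => ω (t.node (q.1 ++ w))) = x →
          A.run t ident ω T (t.node w) = a → ω ∈ F} *
      (coinLaw t).real {ω | A.run t ident ω T (t.node w) = a} ≤ (coinLaw t).real F := by
  have hmem : ∀ q : lowAddresses δ T, q.1 ++ w ∈ t.nodes := fun q =>
    hD _ (by have := mem_lowAddresses.1 q.2; simp; omega)
  have hj : Function.Injective fun q : lowAddresses δ T => t.node (q.1 ++ w) :=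
    FullTree.injective_node_append Subtype.val_injective hmem
  have key := pi_preimage_comp_inter bitStream hj
    {x | ∀ ω, (fun q : lowAddresses δ T => ω (t.node (q.1 ++ w))) = x →
          A.run t ident ω T (t.node w) = a → ω ∈ F}
    {ω | A.run t ident ω T (t.node w) = a} (by
      intro ω ω' h hω
      -- The view of `w` ends at depth `2 T + 1`, while the low nodes start at depth `2 T + 2`.
      have := A.state_eq_of_agree hD (ident := ident) (ident' := ident) (r := ω) (r' := ω')
        (z := []) (z' := []) T w (by omega) (by simp; omega) (by simp; omega) fun u _ hu => by
          refine ⟨rfl, h _ ?_⟩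
          rintro ⟨q, hq⟩
          have hq' := congrArg (fun v => v.1.length) hq
          have := mem_lowAddresses.1 q.2
          simp only [t.val_node (hmem q), List.append_nil,
            t.val_node (hD u (by omega)), List.length_append] at hq'
          omega
      rw [List.append_nil] at this
      exact (congrArg A.output this).symm.trans hω)
  have key' := congrArg ENNReal.toReal key
  rw [ENNReal.toReal_mul] at key'
  refine key'.symm.trans_le (measureReal_mono (μ := coinLaw t) ?_)
  rintro ω ⟨h1, h2⟩
  exact h1 ω rfl h2

end LocalAlgorithm

/-! ### From runs to a certificate. -/

namespace LCL

variable {δ : ℕ} {L : Type*}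

/-- If an algorithm is run near finitely many roots, one for each label in `S`, with common
identifiers and randomness at low addresses, such that all runs are locally correct and use labels
in `S` only, then the runs form a certificate. -/
theorem hasLogStarCertificate_of_runs {P : LCL δ L} {S : Set L} (hS : S.Nonempty)
    {R : Type} (A : LocalAlgorithm δ L R) {t : FullTree δ} {T : ℕ}
    (hD : ∀ u : List (Fin δ), u.length ≤ 4 * T + 4 → u ∈ t.nodes)
    (I : lowAddresses δ T → ℕ) (x : lowAddresses δ T → R)
    (h : ∀ σ ∈ S, ∃ (w : List (Fin δ)) (ident : t.Node → ℕ) (ω : t.Node → R),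
      w.length = T + 1 ∧ (∀ q : lowAddresses δ T, ident (t.node (q.1 ++ w)) = I q) ∧
      (∀ q : lowAddresses δ T, ω (t.node (q.1 ++ w)) = x q) ∧
      A.run t ident ω T (t.node w) = σ ∧ P.IsSolution t (A.run t ident ω T) ∧
      ∀ q : List (Fin δ), q.length ≤ 2 * T + 2 → A.run t ident ω T (t.node (q ++ w)) ∈ S) :
    P.HasLogStarCertificate := by
  -- The labelings of a certificate are indexed by all of `L`; outside `S` the data of any label of
  -- `S` serve as a default.
  have h' : ∀ σ, ∃ (w : List (Fin δ)) (ident : t.Node → ℕ) (ω : t.Node → R), σ ∈ S →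
      w.length = T + 1 ∧ (∀ q : lowAddresses δ T, ident (t.node (q.1 ++ w)) = I q) ∧
      (∀ q : lowAddresses δ T, ω (t.node (q.1 ++ w)) = x q) ∧
      A.run t ident ω T (t.node w) = σ ∧ P.IsSolution t (A.run t ident ω T) ∧
      ∀ q : List (Fin δ), q.length ≤ 2 * T + 2 → A.run t ident ω T (t.node (q ++ w)) ∈ S := by
    intro σ
    by_cases hσ : σ ∈ S
    · obtain ⟨w, ident, ω, hh⟩ := h σ hσ
      exact ⟨w, ident, ω, fun _ => hh⟩
    · obtain ⟨τ, hτ⟩ := hS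
      obtain ⟨w, ident, ω, -⟩ := h τ hτ
      exact ⟨w, ident, ω, fun hσ' => absurd hσ' hσ⟩
  choose w ident ω hh using h'
  refine ⟨S, 2 * T + 2, fun σ v => A.run t (ident σ) (ω σ) T (t.node (v.1 ++ w σ)), hS, by omega,
    fun σ hσ v => (hh σ hσ).2.2.2.2.2 v.1 (FullTree.mem_complete.1 v.2), ?_, ?_, ?_⟩
  · intro σ hσ v hv
    obtain ⟨hw, -, -, -, hsol, -⟩ := hh σ hσ
    have hmem : ∀ q : List (Fin δ), q.length ≤ 2 * T + 3 → q ++ w σ ∈ t.nodes := fun q hq =>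
      hD _ (by simp; omega)
    have hv2 := FullTree.mem_complete.1 v.2
    have hint : t.IsInternal (t.node (v.1 ++ w σ)) := by
      intro i
      rw [t.val_node (hmem v.1 (by omega))]
      exact hmem (i :: v.1) (by simp; omega)
    obtain ⟨ρ, hρ⟩ := hsol _ hint
    refine ⟨ρ, ?_⟩
    convert hρ using 4 with i
    refine Subtype.ext ?_
    have h1 : ((FullTree.complete δ (2 * T + 2)).child v hv (ρ i)).1 ++ w σ
        = ρ i :: (v.1 ++ w σ) := rfl
    rw [h1, t.val_node (u := ρ i :: (v.1 ++ w σ)) (hmem (ρ i :: v.1) (by simp; omega))]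
    exact congrArg (ρ i :: ·) (t.val_node (hmem v.1 (by omega))).symm
  · intro σ hσ τ hτ
    -- The identity works: leaves with the same relative address see the same low identifiers,
    -- randomness and port numbers.
    refine ⟨Equiv.refl _, fun v => by simp, fun v hv => ?_⟩
    obtain ⟨hw, hI, hx, -⟩ := hh σ hσ
    obtain ⟨hw', hI', hx', -⟩ := hh τ hτ
    have hlen : v.1.length = 2 * T + 2 := by
      refine le_antisymm (FullTree.mem_complete.1 v.2) ?_
      by_contra hlt
      exact hv fun i => FullTree.mem_complete.2 (by simp; omega)
    refine congrArg A.output (A.state_eq_of_agree hD T v.1 (by omega) (by omega) (by omega)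
      fun u hu1 hu2 => ?_)
    have hu : u ∈ lowAddresses δ T := mem_lowAddresses.2 ⟨by omega, by omega⟩
    exact ⟨(hI' ⟨u, hu⟩).trans (hI ⟨u, hu⟩).symm, (hx' ⟨u, hu⟩).trans (hx ⟨u, hu⟩).symm⟩
  · intro σ hσ
    exact (hh σ hσ).2.2.2.1

end LCL

/-! ### A certificate from a fast algorithm. -/

namespace LCL

variable {δ : ℕ} {L : Type*}

/-- `h1` leaves room for the complete top and for fresh low identifiers; `h2` makes the failure
probability `1 / n` small against every threshold `θ j` with `j ≤ ℓ`. -/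
theorem hasLogStarCertificate_of_randSolves (hδ : 0 < δ) [Fintype L] {P : LCL δ L} {N : ℕ → ℕ}
    (hN : ∀ n, n ≤ N n) {A : LocalAlgorithm δ L (ℕ → Bool)} {n T : ℕ} (hn : IsTreeSize δ n)
    (h1 : (Fintype.card L + 1) * (δ + 1) ^ (4 * T + 4) ≤ n)
    (h2 : 4 * Fintype.card L ^ 2 *
      (4 * Fintype.card L ^ 2 * (δ + 1) ^ (2 * T + 2)) ^ Fintype.card L ≤ n)
    (hA : P.RandSolves N A n T) : P.HasLogStarCertificate := by
  classical
  -- The roots lie at depth `T + 1`, the certificate trees reach `2 T + 2` further, and views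
  -- another `T`; one more level makes all nodes seen internal.
  obtain ⟨t, ht, hD⟩ := FullTree.exists_size_eq_of_complete (d := 4 * T + 4) hn
    ((FullTree.size_complete_le _ _).trans
      ((Nat.le_mul_of_pos_left _ (Nat.succ_pos _)).trans h1))
  obtain ⟨ident₀, hident₀, -⟩ := exists_validIds_extending hN t ∅ (fun _ => 0) (by simp) (by simp)
  set w₀ : List (Fin δ) := List.replicate (T + 1) ⟨0, hδ⟩ with hw₀
  set ℓ := Fintype.card L with hℓ
  have hLne : Nonempty L := ⟨A.run t ident₀ (fun _ _ => true) T (t.node w₀)⟩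
  have hℓpos : 0 < ℓ := Fintype.card_pos
  have hℓ1 : (1 : ℝ) ≤ ℓ := by exact_mod_cast hℓpos
  set m : ℕ := (δ + 1) ^ (2 * T + 2) with hm
  have hm1 : (1 : ℝ) ≤ m := by exact_mod_cast Nat.one_le_pow _ _ (Nat.succ_pos δ)
  -- Chosen so that a union bound over at most `m` nodes and `ℓ` rare labels costs `m * ℓ * θ (j +
  -- 1) = θ j / (4 * ℓ)`.
  set B : ℝ := 4 * ℓ ^ 2 * m with hB
  have hB1 : 1 ≤ B := by nlinarith [one_le_pow₀ (n := 2) hℓ1]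
  have hB0 : 0 < B := by linarith
  set θ : ℕ → ℝ := fun j => 1 / (ℓ * B ^ j) with hθ
  have hθpos : ∀ j, 0 < θ j := fun j => by positivity
  -- the labels that occur somewhere with probability at least `θ j`
  set S : ℕ → Finset L := fun j => Finset.univ.filter fun a =>
    ∃ (w z : List (Fin δ)) (ident : t.Node → ℕ), w.length = T + 1 ∧ z.length ≤ 2 * T + 2 ∧
      ValidIds N t ident ∧
      θ j ≤ (coinLaw t).real {ω | A.run t ident ω T (t.node (w ++ z)) = a} with hS
  have hSmono : Monotone S := by
    intro i j hij a ha
    simp only [hS, Finset.mem_filter, Finset.mem_univ, true_and] at ha ⊢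
    obtain ⟨w, z, ident, hw, hz, hid, hp⟩ := ha
    refine ⟨w, z, ident, hw, hz, hid, le_trans ?_ hp⟩
    simp only [hθ]
    gcongr
  obtain ⟨j, hj, hSj⟩ := exists_eq_succ_of_monotone hSmono
  -- Some label has probability at least `1 / ℓ = θ 0` at `w₀`.
  have hSne : (S j).Nonempty := by
    by_contra hempty
    have hlt : ∀ a, (coinLaw t).real {ω | A.run t ident₀ ω T (t.node w₀) = a} < θ 0 := by
      intro a
      by_contra hge
      refine hempty ⟨a, hSmono (Nat.zero_le j) ?_⟩
      simp only [hS, Finset.mem_filter, Finset.mem_univ, true_and]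
      exact ⟨w₀, [], ident₀, by simp [hw₀], by simp, hident₀, by simpa using hge⟩
    have huniv : (⋃ a, {ω | A.run t ident₀ ω T (t.node w₀) = a}) = Set.univ :=
      Set.eq_univ_of_forall fun ω => Set.mem_iUnion.2 ⟨_, rfl⟩
    have hsum : (1 : ℝ) ≤ ∑ a, (coinLaw t).real {ω | A.run t ident₀ ω T (t.node w₀) = a} := by
      rw [← probReal_univ (μ := coinLaw t), ← huniv]
      exact measureReal_iUnion_fintype_le _
    have hsum' := Finset.sum_lt_sum_of_nonempty Finset.univ_nonempty fun a (_ : a ∈ _) => hlt a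
    have : ∑ _a : L, θ 0 = 1 := by
      simp only [hθ, Finset.sum_const, Finset.card_univ, ← hℓ, nsmul_eq_mul, pow_zero, mul_one]
      field_simp
    linarith
  have hrare : ∀ a ∉ S j, ∀ (w z : List (Fin δ)) (ident : t.Node → ℕ), w.length = T + 1 →
      z.length ≤ 2 * T + 2 → ValidIds N t ident →
      (coinLaw t).real {ω | A.run t ident ω T (t.node (w ++ z)) = a} ≤ θ (j + 1) := by
    intro a ha w z ident hw hz hid
    by_contra hlt
    refine ha ?_
    rw [hSj]
    simp only [hS, Finset.mem_filter, Finset.mem_univ, true_and]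
    exact ⟨w, z, ident, hw, hz, hid, (not_le.1 hlt).le⟩
  have hwit : ∀ σ : S j, ∃ (w z : List (Fin δ)) (ident : t.Node → ℕ), w.length = T + 1 ∧
      z.length ≤ 2 * T + 2 ∧ ValidIds N t ident ∧
      θ j ≤ (coinLaw t).real {ω | A.run t ident ω T (t.node (w ++ z)) = σ.1} := fun σ => by
    simpa only [hS, Finset.mem_filter, Finset.mem_univ, true_and] using σ.2
  choose w z idW hw hz hidW hp using hwit
  have hcardS : Fintype.card (S j) ≤ ℓ := by simpa using (S j).card_le_univ
  obtain ⟨I, hI⟩ := exists_validIds_common_low hN hD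
    ((Nat.mul_le_mul_right _ (Nat.succ_le_succ hcardS)).trans (h1.trans_eq ht.symm)) w z hw hz
    idW hidW
  choose ident hid hidroot hidlow using hI
  set F : S j → Set (t.Node → ℕ → Bool) := fun σ =>
    {ω | ¬ P.IsSolution t (A.run t (ident σ) ω T)} ∪
      ⋃ q ∈ (FullTree.complete δ (2 * T + 2)).nodes, ⋃ a ∈ Finset.univ \ S j,
        {ω | A.run t (ident σ) ω T (t.node (q ++ w σ)) = a} with hF
  have hFle : ∀ σ, (coinLaw t).real (F σ) ≤ 1 / (n : ℝ) + m * (ℓ * θ (j + 1)) := by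
    intro σ
    refine (measureReal_union_le _ _).trans
      (add_le_add (hA.measureReal_not_isSolution_le ht (hid σ)) ?_)
    refine (measureReal_biUnion_finset_le _ _).trans ((Finset.sum_le_card_nsmul _ _ (ℓ * θ (j + 1))
      fun q hq => ?_).trans ?_)
    · refine (measureReal_biUnion_finset_le _ _).trans ((Finset.sum_le_card_nsmul _ _ (θ (j + 1))
        fun a ha => ?_).trans ?_)
      · have hq' := FullTree.mem_complete.1 hq
        -- Resplitting after `T + 1` letters leaves a rest of length at most `2 T + 2`: the range of
        -- `z` in `S` covers the whole certificate tree.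
        have hsplit : q ++ w σ = (q ++ w σ).take (T + 1) ++ (q ++ w σ).drop (T + 1) :=
          (List.take_append_drop _ _).symm
        have hwσ := hw σ
        rw [hsplit]
        exact hrare a (Finset.mem_sdiff.1 ha).2 _ _ _ (by simp; omega) (by simp; omega) (hid σ)
      · rw [nsmul_eq_mul]
        have : ((Finset.univ \ S j).card : ℝ) ≤ ℓ := by exact_mod_cast Finset.card_le_univ _
        exact mul_le_mul_of_nonneg_right this (hθpos _).le
    · rw [nsmul_eq_mul]
      have : ((FullTree.complete δ (2 * T + 2)).nodes.card : ℝ) ≤ m := by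
        exact_mod_cast FullTree.size_complete_le δ (2 * T + 2)
      exact mul_le_mul_of_nonneg_right this (mul_nonneg (by positivity) (hθpos _).le)
  have hFθ : ∀ σ, (coinLaw t).real (F σ) ≤ θ j / (2 * ℓ) := by
    intro σ
    refine (hFle σ).trans ?_
    have e1 : m * (ℓ * θ (j + 1)) = θ j / (4 * ℓ) := by
      simp only [hθ, hB]
      field_simp
      ring
    have e2 : 1 / (n : ℝ) ≤ θ j / (4 * ℓ) := by
      have hn' : (4 * ℓ ^ 2 * B ^ ℓ : ℝ) ≤ n := by rw [hB]; exact_mod_cast h2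
      have hpow : B ^ j ≤ B ^ ℓ := pow_le_pow_right₀ hB1 hj
      have : θ j / (4 * ℓ) = 1 / (4 * ℓ ^ 2 * B ^ j) := by
        simp only [hθ]
        field_simp
      rw [this]
      refine one_div_le_one_div_of_le (by positivity) (le_trans ?_ hn')
      gcongr
    have e3 : θ j / (2 * ℓ) = θ j / (4 * ℓ) + θ j / (4 * ℓ) := by
      field_simp
      ring
    linarith
  obtain ⟨x, hx⟩ := exists_forall_notMem_of_measureReal_lt
    (Measure.pi fun _ : lowAddresses δ T => bitStream)
    (fun σ : S j => {x | ∀ ω, (fun q : lowAddresses δ T => ω (t.node (q.1 ++ w σ))) = x →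
      A.run t (ident σ) ω T (t.node (w σ)) = σ.1 → ω ∈ F σ}) hcardS (fun σ => by
      have hle := A.pi_real_mul_coinLaw_real_le hD (ident σ) (hw σ) σ.1 (F σ)
      -- The label `σ` is as likely at `w σ` under the combined identifiers as at its witness, hence
      -- at least `θ j`; the bad low randomness has probability at most `1 / (2 * ℓ)`.
      rw [A.coinLaw_real_run_eq hD (hw σ) (hz σ) (hidroot σ)] at hle
      have h3 := ((mul_le_mul_of_nonneg_left (hp σ) measureReal_nonneg).trans hle).trans (hFθ σ)
      rw [le_div_iff₀ (by positivity)] at h3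
      have h4 := hθpos j
      by_contra hge
      nlinarith)
  refine hasLogStarCertificate_of_runs (P := P) (S := (S j : Set L)) hSne A hD I x fun σ hσ => ?_
  have hσx := hx ⟨σ, hσ⟩
  simp only [Set.mem_ofPred_eq, not_forall] at hσx
  obtain ⟨ω, hωx, hωσ, hωF⟩ := hσx
  simp only [hF, Set.mem_union, Set.mem_iUnion, Set.mem_ofPred_eq, not_or, not_not,
    not_exists] at hωF
  refine ⟨w ⟨σ, hσ⟩, ident ⟨σ, hσ⟩, ω, hw _, hidlow _, congrFun hωx, hωσ, hωF.1, fun q hq => ?_⟩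
  by_contra hnot
  exact hωF.2 q (FullTree.mem_complete.2 hq) _
    (Finset.mem_sdiff.2 ⟨Finset.mem_univ _, hnot⟩) rfl

/-! ### Asymptotic lower bounds. -/

/-- Without a certificate, `T` rounds are not enough on trees of size at least `K ^ (T + 1)`. -/
theorem exists_lt_pow_of_randSolves (hδ : 0 < δ) [Finite L] {P : LCL δ L} {N : ℕ → ℕ}
    (hN : ∀ n, n ≤ N n) (hcert : ¬ P.HasLogStarCertificate) :
    ∃ K : ℕ, 2 ≤ K ∧ ∀ (A : LocalAlgorithm δ L (ℕ → Bool)) (n T : ℕ), IsTreeSize δ n →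
      P.RandSolves N A n T → n < K ^ (T + 1) := by
  have := Fintype.ofFinite L
  set ℓ := Fintype.card L with hℓ
  have hX1 : 4 ≤ 4 * (ℓ + 1) ^ 2 * (δ + 1) ^ 4 := by
    have h1 : 1 ≤ (ℓ + 1) ^ 2 := Nat.one_le_pow _ _ (Nat.succ_pos _)
    have h2 : 1 ≤ (δ + 1) ^ 4 := Nat.one_le_pow _ _ (Nat.succ_pos _)
    nlinarith
  -- `K ^ (T + 1)` dominates `X ^ (ℓ + 1)` below; one factor `X` covers `4 * ℓ ^ 2` and the other
  -- `ℓ` cover the power in `h2`. Using `ℓ + 1` keeps `K ≥ 2` even for empty `L`.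
  refine ⟨(4 * (ℓ + 1) ^ 2 * (δ + 1) ^ 4) ^ (ℓ + 1), ?_, fun A n T hn hA => ?_⟩
  · calc 2 ≤ 4 * (ℓ + 1) ^ 2 * (δ + 1) ^ 4 := by omega
      _ ≤ _ := Nat.le_self_pow (Nat.succ_ne_zero _) _
  by_contra! hle
  set X := 4 * (ℓ + 1) ^ 2 * (δ + 1) ^ (4 * T + 4) with hX
  have hXn : X ^ (ℓ + 1) ≤ n := by
    refine le_trans ?_ hle
    rw [← pow_mul, mul_comm (ℓ + 1), pow_mul]
    refine Nat.pow_le_pow_left ?_ _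
    rw [mul_pow, ← pow_mul, show 4 * (T + 1) = 4 * T + 4 by ring]
    exact Nat.mul_le_mul_right _ (Nat.le_self_pow (Nat.succ_ne_zero _) _)
  have hXpos : 0 < X := by positivity
  have hpow : 1 ≤ (δ + 1) ^ (4 * T + 4) := Nat.one_le_pow _ _ (Nat.succ_pos _)
  have hsq : ℓ ^ 2 ≤ (ℓ + 1) ^ 2 := Nat.pow_le_pow_left (Nat.le_succ _) _
  refine hcert (hasLogStarCertificate_of_randSolves hδ hN hn ?_ ?_ hA)
  · refine le_trans ?_ ((Nat.le_self_pow (Nat.succ_ne_zero ℓ) X).trans hXn)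
    exact Nat.mul_le_mul_right _ (by nlinarith)
  · refine le_trans ?_ hXn
    rw [pow_succ' X ℓ]
    refine Nat.mul_le_mul ?_ (Nat.pow_le_pow_left ?_ _)
    · exact (Nat.mul_le_mul_left 4 hsq).trans (Nat.le_mul_of_pos_right _ hpow)
    · exact Nat.mul_le_mul (Nat.mul_le_mul_left 4 hsq)
        (Nat.pow_le_pow_right (Nat.succ_pos _) (by omega))

theorem isOmegaLog_randComplexity (hδ : 0 < δ) [Finite L] {P : LCL δ L} {N : ℕ → ℕ}
    (hN : ∀ n, n ≤ N n) (hcert : ¬ P.HasLogStarCertificate) :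
    IsOmegaLog δ (P.randComplexity N) := by
  obtain ⟨K, hK, hlt⟩ := exists_lt_pow_of_randSolves hδ hN hcert
  have hlogK : 0 < Real.log K := Real.log_pos (by exact_mod_cast hK)
  -- From `log n < (T + 1) log K`; for `n ≥ K ^ 2` the extra `log K` is at most half of `log n`,
  -- hence the factor `2`.
  refine ⟨1 / (2 * Real.log K), by positivity, K ^ 2, fun n hn hsize => ?_⟩
  have hn0 : 0 < n := lt_of_lt_of_le (by positivity) hn
  have hlogn : 2 * Real.log K ≤ Real.log n := by
    have := Real.log_le_log (by positivity) (show ((K ^ 2 : ℕ) : ℝ) ≤ n by exact_mod_cast hn)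
    simpa [Real.log_pow] using this
  have hceil : ((⌈1 / (2 * Real.log K) * Real.log n⌉₊ : ℕ) : ℕ∞) ≤ P.randComplexity N n := by
    refine le_iInf₂ fun T hT => ?_
    obtain ⟨A, hA⟩ := hT
    rw [Nat.cast_le, Nat.ceil_le]
    have h1 := Real.log_lt_log (by exact_mod_cast hn0)
      (show (n : ℝ) < ((K ^ (T + 1) : ℕ) : ℝ) by exact_mod_cast hlt A n T hsize hA)
    simp only [Nat.cast_pow, Real.log_pow] at h1
    push_cast at h1
    rw [one_div_mul_eq_div, div_le_iff₀ (by positivity)]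
    linarith
  calc ENNReal.ofReal (1 / (2 * Real.log K) * Real.log n)
      ≤ ((⌈1 / (2 * Real.log K) * Real.log n⌉₊ : ℕ) : ENNReal) := by
        rw [← ENNReal.ofReal_natCast]
        exact ENNReal.ofReal_le_ofReal (Nat.le_ceil _)
    _ = (((⌈1 / (2 * Real.log K) * Real.log n⌉₊ : ℕ) : ℕ∞) : ENNReal) := by simp
    _ ≤ _ := ENat.toENNReal_le.2 hceil

/-- A deterministic algorithm is a randomized one that ignores its random bits. -/
theorem randComplexity_le_detComplexity (P : LCL δ L) (N : ℕ → ℕ) (n : ℕ) :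
    P.randComplexity N n ≤ P.detComplexity N n := by
  refine le_iInf₂ fun T hT => iInf₂_le T ?_
  obtain ⟨A, hA⟩ := hT
  let A' : LocalAlgorithm δ L (ℕ → Bool) :=
    { State := A.State
      Msg := A.Msg
      init := fun n i p c _ => A.init n i p c ()
      toParent := A.toParent
      toChild := A.toChild
      update := A.update
      output := A.output }
  have hFP : ∀ (t : FullTree δ) (s : t.Node → A.State) (v : t.Node),
      A'.fromParent t s v = A.fromParent t s v := by
    rintro t s ⟨_ | ⟨i, p⟩, h⟩ <;> rfl
  have hstate : ∀ (t : FullTree δ) (ident : t.Node → ℕ) (ω : t.Node → ℕ → Bool) (k : ℕ),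
      A'.state t ident ω k = A.state t ident (fun _ => ()) k := by
    intro t ident ω k
    induction k with
    | zero => rfl
    | succ k ih =>
      funext v
      simp only [LocalAlgorithm.state, ih, hFP]
      rfl
  refine ⟨A', fun t ht ident hid => ?_⟩
  have hrun : ∀ ω, A'.run t ident ω T = A.run t ident (fun _ => ()) T := fun ω => by
    funext v
    simp only [LocalAlgorithm.run, hstate]
    rfl
  simp only [hrun, hA t ht ident hid]
  refine ⟨fun v a => MeasurableSet.const _, ?_⟩
  rw [Set.ofPred_true, probReal_univ]
  linarith [show (0 : ℝ) ≤ 1 / (n : ℝ) by positivity]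

end LCL

theorem IsOmegaLog.mono {δ : ℕ} {f g : ℕ → ℕ∞} (hf : IsOmegaLog δ f) (h : ∀ n, f n ≤ g n) :
    IsOmegaLog δ g := by
  obtain ⟨c, hc, n₀, hn⟩ := hf
  exact ⟨c, hc, n₀, fun n h1 h2 => (hn n h1 h2).trans (ENat.toENNReal_le.2 (h n))⟩

theorem IsOmegaLog.exceedsSublog {δ : ℕ} {f : ℕ → ℕ∞} (hf : IsOmegaLog δ f) :
    ExceedsSublog δ f := by
  obtain ⟨c, hc, n₀, hn⟩ := hf
  intro g hg
  obtain ⟨n₁, hn₁⟩ := Filter.eventually_atTop.1 (hg.bound (half_pos hc))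
  refine ⟨max 2 (max n₀ n₁), fun n h1 h2 => lt_of_lt_of_le ?_ (hn n (by omega) h2)⟩
  have hlog : 0 < Real.log n := Real.log_pos (by exact_mod_cast (show 1 < n by omega))
  have hb := hn₁ n (by omega)
  rw [Real.norm_of_nonneg hlog.le] at hb
  refine (ENNReal.ofReal_lt_ofReal_iff (mul_pos hc hlog)).2 ?_
  have := (le_abs_self (g n)).trans hb
  nlinarith [mul_pos hc hlog]

theorem mainTheorem5 {δ : ℕ} (hδ : 0 < δ) {L : Type*} [Finite L] (P : LCL δ L)
    (N : ℕ → ℕ) (hN : ∀ n, n ≤ N n) (hcert : ¬ P.HasLogStarCertificate) :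
    (IsOmegaLog δ (P.detComplexity N) ∧ IsOmegaLog δ (P.randComplexity N)) ∧
      (ExceedsSublog δ (P.detComplexity N) ∧ ExceedsSublog δ (P.randComplexity N)) := by
  have hrand := LCL.isOmegaLog_randComplexity hδ hN hcert
  have hdet := hrand.mono (P.randComplexity_le_detComplexity N)
  exact ⟨⟨hdet, hrand⟩, hdet.exceedsSublog, hrand.exceedsSublog⟩
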